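/- **Conventions.** A qutrit has computational basis $|0\rangle,|1\rangle,|2\rangle$ (indices in $\mathbb Z_3$); $\omega=e^{2\pi i/3}$; $|+\rangle=|0\rangle+|1\rangle+|2\rangle$, $|\omega\rangle=|0\rangle+\omega|1\rangle+\bar\omega|2\rangle$, $|\bar\omega\rangle=|0\rangle+\bar\omega|1\rangle+\omega|2\rangle$. For a phase $(a,b)\in\mathcal A=\mathbb Z_3^2$ put $\alpha=2\pi a/3$, $\beta=2\pi b/3$; the green, respectively red, spider with this phase, $k$ inputs and $l$ outputs is interpreted as $|0\rangle^{\otimes l}\langle0|^{\otimes k}+e^{i\alpha}|1\rangle^{\otimes l}\langle1|^{\otimes k}+e^{i\beta}|2\rangle^{\otimes l}\langle2|^{\otimes k}$, respectively $|+\rangle^{\otimes l}\langle+|^{\otimes k}+e^{i\alpha}|\omega\rangle^{\otimes l}\langle\omega|^{\otimes k}+e^{i\beta}|\bar\omega\rangle^{\otimes l}\langle\bar\omega|^{\otimes k}$. The $H$ node is interpreted as $|+\rangle\langle0|+|\omega\rangle\langle1|+|\bar\omega\rangle\langle2|$ and the $H^\dagger$ node as its adjoint. Two diagrams are *equal under the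 standard interpretation* if their interpretations agree up to a non-zero complex scalar. Let $\mathcal P=\{(1,1),(2,2)\}$ and $\mathcal M=\{(0,0),(1,2),(2,1)\}$. **GS-LC diagrams.** Let $G$ be a loopless $\mathbb Z_3$-weighted graph on $n$ vertices. Its graph state diagram has a phase-zero green node with one output for each vertex, and an $H$ node (respectively an $H^\dagger$ node) joining the green nodes of $u$ and $v$ for each edge $\{u,v\}$ of weight $1$ (respectively $2$). A *GS-LC diagram* on $n$ qutrits is a graph state diagram with a single-qutrit Clifford diagram $U_v$ (the *vertex operator*) applied to the output of each vertex $v$; its interpretation is $\big(\bigotimes_v U_v\big)|G\rangle$. **Reduced form.** For each vertex $v$ fix a form of vertex operators with a red node: a phase $p_v\in\mathcal P$, and one of the two families, indexed by $m\in\mathcal M$: (i) a green node of phase $p_v$ followed by a red node of phase $p_v+m$; or (ii) a green node of phase $p_v+m$ followed by a red node of phase $p_v$. Let $\mathcal R_v$ consist of the nine single green nodes of phase $a\in\mathcal A$ and of the three operators of the family chosen at $v$. A GS-LC diagram is an *rGS-LC diagram* (with respect to these choices) if $U_v\in\mathcal R_v$ for every $v$ and no two adjacent vertices both have a red node in their vertex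 operators. **Simplified pairs.** A pair of rGS-LC diagrams on the same $n$ qutrits is *simplified* if there are no qutrits $a,b$ such that $a$ has a red node in its vertex operator in the first diagram but not in the second, $b$ has a red node in its vertex operator in the second diagram but not in the first, and $a$ and $b$ are adjacent in at least one of the two diagrams. **Theorem.** For all $n$ and every choice of forms as above, the two component diagrams of any simplified pair of rGS-LC diagrams on $n$ qutrits (both with respect to the same choice of forms) are equal under the standard interpretation if and only if they are identical, that is, they have the same weighted graph and the same vertex operator at every vertex. -/

import Mathlib

namespace QutritZX

noncomputable section

/-- Computational basis labels of a qutrit. -/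
abbrev Trit := ZMod 3

/-- The primitive cube root of unity `e^{2πi/3}`. -/
def omega : ℂ := Complex.exp (2 * (Real.pi : ℂ) / 3 * Complex.I)

/-- Coordinates of the `Z`-basis vector `|k⟩`. -/
def ketZ (k j : Trit) : ℂ := if j = k then 1 else 0

/-- Coordinates of the (unnormalised) `X`-basis vectors `|+⟩, |ω⟩, |ω̄⟩`, for `k = 0, 1, 2`:
the `j`-th coordinate is `ω ^ (k j)`. -/
def ketX (k j : Trit) : ℂ := omega ^ (k * j).val

/-- The coefficients `1, e^{iα}, e^{iβ}` of a spider with phase angles `α, β`. -/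
def spiderCoeff (α β : ℝ) (k : Trit) : ℂ :=
  if k = 0 then 1
  else if k = 1 then Complex.exp (α * Complex.I)
  else Complex.exp (β * Complex.I)

/-- The spider over the basis `ket`, with input legs `ι` and output legs `κ`:
`∑ₖ cₖ |ket k⟩^{⊗ κ} ⟨ket k|^{⊗ ι}` with `c = (1, e^{iα}, e^{iβ})`. -/
def spider (ket : Trit → Trit → ℂ) (ι κ : Type*) [Fintype ι] [Fintype κ] (α β : ℝ) :
    Matrix (κ → Trit) (ι → Trit) ℂ :=
  fun y x => ∑ k : Trit,
    spiderCoeff α β k * (∏ j, ket k (y j)) * ∏ i, star (ket k (x i))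

/-- Interpretation of the green (`Z`) spider. -/
def greenSpider (ι κ : Type*) [Fintype ι] [Fintype κ] (α β : ℝ) :
    Matrix (κ → Trit) (ι → Trit) ℂ :=
  spider ketZ ι κ α β

/-- Interpretation of the red (`X`) spider. -/
def redSpider (ι κ : Type*) [Fintype ι] [Fintype κ] (α β : ℝ) :
    Matrix (κ → Trit) (ι → Trit) ℂ :=
  spider ketX ι κ α β

/-- Interpretation of the `H` node: `|+⟩⟨0| + |ω⟩⟨1| + |ω̄⟩⟨2|`. -/
def hadamard : Matrix Trit Trit ℂ :=
  fun y x => ∑ k : Trit, ketX k y * star (ketZ k x)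

/-- Interpretation of the `H†` node: `|0⟩⟨+| + |1⟩⟨ω| + |2⟩⟨ω̄|`. -/
def hadamardDag : Matrix Trit Trit ℂ :=
  fun y x => ∑ k : Trit, ketZ k y * star (ketX k x)

/-- The group `𝒜` of stabilizer phases: `(a, b)` stands for the pair of phase angles
`(2πa/3, 2πb/3)`. -/
abbrev Phase := ZMod 3 × ZMod 3

/-- The angle `2πa/3`. -/
def angle (a : ZMod 3) : ℝ := 2 * Real.pi / 3 * (a.val : ℝ)

/-- `𝒫 = {(1,1), (2,2)}`. -/
def phaseP : Set Phase := {(1, 1), (2, 2)}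

/-- `ℳ = {(0,0), (1,2), (2,1)}`. -/
def phaseM : Set Phase := {(0, 0), (1, 2), (2, 1)}

/-- The nodes with one input and one output of the stabilizer calculus. -/
inductive Node where
  | green (a : Phase)
  | red (a : Phase)
  | had
  | hadDag

/-- The standard interpretation of a node, as a `3 × 3` matrix. -/
def Node.interp : Node → Matrix Trit Trit ℂ
  | .green a => fun y x =>
      greenSpider Unit Unit (angle a.1) (angle a.2) (fun _ => y) (fun _ => x)
  | .red a => fun y x =>
      redSpider Unit Unit (angle a.1) (angle a.2) (fun _ => y) (fun _ => x)
  | .had => hadamard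
  | .hadDag => hadamardDag

/-- A single-qutrit Clifford diagram: a sequence of nodes on one wire, read from top (input)
to bottom (output). -/
abbrev VertexOp := List Node

/-- The standard interpretation of a single-wire diagram: the head of the list acts first. -/
def VertexOp.interp : VertexOp → Matrix Trit Trit ℂ
  | [] => 1
  | g :: U => VertexOp.interp U * g.interp

/-- The diagram contains a red node. -/
def VertexOp.HasRed (U : VertexOp) : Prop := ∃ a : Phase, Node.red a ∈ U

/-- `ℤ₃`-weighted graphs without loops on the vertices `0, …, n-1`. -/
@[ext]
structure WeightedGraph (n : ℕ) where
  adj : Matrix (Fin n) (Fin n) (ZMod 3)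
  symm : ∀ u v, adj u v = adj v u
  loopless : ∀ v, adj v v = 0

namespace WeightedGraph

variable {n : ℕ} (G : WeightedGraph n)

/-- `u` and `v` are joined by an edge (of nonzero weight). -/
def Adj (u v : Fin n) : Prop := G.adj u v ≠ 0

instance (u v : Fin n) : Decidable (G.Adj u v) := inferInstanceAs (Decidable (_ ≠ _))

theorem Adj.symm' {G : WeightedGraph n} {u v : Fin n} (h : G.Adj u v) : G.Adj v u := by
  unfold Adj at *
  rwa [G.symm v u]

/-- The neighbours of `v`. -/
abbrev Nbr (v : Fin n) := {u : Fin n // G.Adj v u}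

/-- The edges, each unordered pair being listed once. -/
abbrev Edge := {e : Fin n × Fin n // e.1 < e.2 ∧ G.Adj e.1 e.2}

/-- The interpretation of the node sitting on an edge of weight `w`: an `H` node if `w = 1`,
an `H†` node if `w = 2`. -/
def edgeNode (w : ZMod 3) : Matrix Trit Trit ℂ :=
  if w = 1 then hadamard else hadamardDag

/-- The standard interpretation of the graph state diagram of `G`, as a vector on `n` qutrits:
every vertex `v` is a green node of phase zero without inputs, having one output (the leg `none`)
and one leg for each neighbour; every edge is an `H` or `H†` node joining the corresponding legs
of its two end points. The wires `z` between green nodes and edge nodes are summed over. -/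
def stateInterp (w : Fin n → Trit) : ℂ :=
  ∑ z : ((v : Fin n) → G.Nbr v → Trit),
    (∏ v, greenSpider Empty (Option (G.Nbr v)) 0 0
        (fun l => l.elim (w v) (z v)) (fun e => e.elim)) *
    ∏ e : G.Edge, edgeNode (G.adj e.1.1 e.1.2)
      (z e.1.2 ⟨e.1.1, e.2.2.symm'⟩) (z e.1.1 ⟨e.1.2, e.2.2⟩)

end WeightedGraph

/-- A GS-LC diagram on `n` qutrits: a graph state diagram with a single-qutrit Clifford diagram
(the vertex operator) applied to each output. -/
@[ext]
structure GSLC (n : ℕ) where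
  graph : WeightedGraph n
  op : Fin n → VertexOp

/-- The standard interpretation `(⨂ᵥ ⟦Uᵥ⟧) |G⟩` of a GS-LC diagram, as a vector on `n` qutrits. -/
def GSLC.interp {n : ℕ} (D : GSLC n) (y : Fin n → Trit) : ℂ :=
  ∑ w : Fin n → Trit, (∏ v, (D.op v).interp (y v) (w v)) * D.graph.stateInterp w

/-- Equality under the standard interpretation, which is taken up to a non-zero scalar. -/
def GSLC.EqualInterp {n : ℕ} (D₁ D₂ : GSLC n) : Prop :=
  ∃ c : ℂ, c ≠ 0 ∧ D₁.interp = c • D₂.interp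

/-- A form for the reduced vertex operators that include a red node: the phase `p ∈ 𝒫` carried by
the green node and the red node below it, and which of the two nodes carries in addition
the variable phase `m ∈ ℳ`. -/
structure RedForm where
  p : Phase
  mem : p ∈ phaseP
  onRed : Bool

/-- The reduced vertex operator with a red node, of the given form, with parameter `m`. -/
def RedForm.op (c : RedForm) (m : Phase) : VertexOp :=
  if c.onRed then [.green c.p, .red (c.p + m)] else [.green (c.p + m), .red c.p]

/-- The set `ℛ` of reduced vertex operators: the nine green nodes, and the three operators with
a red node of the chosen form. -/
def reducedOps (c : RedForm) : Set VertexOp :=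
  {U | (∃ a : Phase, U = [.green a]) ∨ ∃ m ∈ phaseM, U = c.op m}

/-- Reduced GS-LC diagrams, `c v` being the form of the operators with a red node at `v`. -/
structure GSLC.IsReduced {n : ℕ} (c : Fin n → RedForm) (D : GSLC n) : Prop where
  op_mem : ∀ v, D.op v ∈ reducedOps (c v)
  not_both_red : ∀ u v, D.graph.Adj u v → ¬ ((D.op u).HasRed ∧ (D.op v).HasRed)

/-- Simplified pairs. -/
def GSLC.IsSimplifiedPair {n : ℕ} (D₁ D₂ : GSLC n) : Prop :=
  ¬ ∃ a b : Fin n,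
    ((D₁.op a).HasRed ∧ ¬ (D₂.op a).HasRed) ∧
    ((D₂.op b).HasRed ∧ ¬ (D₁.op b).HasRed) ∧
    (D₁.graph.Adj a b ∨ D₂.graph.Adj a b)

end

end QutritZX

namespace QutritZX

/-! ### The additive character `k ↦ ω ^ k` of `ℤ₃` -/

/-! A graph state has amplitudes `chi (G.phaseForm w)`, with a quadratic form in the exponent. A red
vertex operator is, up to nonzero output factors, a Fourier kernel (`RedForm.exists_interp_op`). The
red vertices are independent, so the exponent is affine in their inputs. Summing over these inputs
gives one linear equation per red vertex (`sum_prod_mul_stateInterp`): the support is the graph of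
an affine function of the green coordinates.

Proportional states have equal supports. Simplifiedness then forces equal red sets
(`redSet_subset`); the constants and coefficients of the affine function give the red parameters and
the edges at red vertices. The output factors now agree and cancel, which leaves a polynomial phase
in the green coordinates. Its values at zero, at basis vectors and at sums of two of them give the
scalar, the green phases and the remaining edges (`eq_of_interp_eq`). -/

theorem isPrimitiveRoot_omega : IsPrimitiveRoot omega 3 := by
  have h := Complex.isPrimitiveRoot_exp 3 (by norm_num)
  have e : omega = Complex.exp (2 * Real.pi * Complex.I / (3 : ℕ)) := by
    unfold omega
    congr 1
    push_cast
    ring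
  rwa [e]

/-- The additive character `k ↦ ω ^ k` of `ℤ₃`. -/
noncomputable def chi : AddChar (ZMod 3) ℂ := AddChar.zmodChar 3 isPrimitiveRoot_omega.pow_eq_one

theorem chi_apply (k : ZMod 3) : chi k = omega ^ k.val := AddChar.zmodChar_apply _ k

theorem chi_injective : Function.Injective chi := by
  intro a b h
  rw [chi_apply, chi_apply] at h
  exact ZMod.val_injective 3 (isPrimitiveRoot_omega.pow_inj a.val_lt b.val_lt h)

theorem chi_ne_zero (k : ZMod 3) : chi k ≠ 0 := by
  rw [chi_apply]
  exact pow_ne_zero _ (isPrimitiveRoot_omega.ne_zero (by norm_num))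

theorem chi_sum {ι : Type*} (s : Finset ι) (f : ι → ZMod 3) :
    chi (∑ i ∈ s, f i) = ∏ i ∈ s, chi (f i) := by
  classical
  induction s using Finset.induction_on with
  | empty => simp
  | insert i s hi ih => rw [Finset.sum_insert hi, Finset.prod_insert hi, chi.map_add_eq_mul, ih]

theorem star_chi (k : ZMod 3) : star (chi k) = chi (-k) := by
  rw [AddChar.map_neg_eq_conj]
  rfl

theorem sum_chi_mul (b : ZMod 3) : ∑ x, chi (b * x) = if b = 0 then 3 else 0 := by
  have h := AddChar.sum_mulShift b
    (AddChar.zmodChar_primitive_of_primitive_root 3 isPrimitiveRoot_omega)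
  simpa [mul_comm, chi, ZMod.card] using h

theorem exp_angle (a : ZMod 3) : Complex.exp (angle a * Complex.I) = chi a := by
  rw [chi_apply, omega, ← Complex.exp_nat_mul]
  congr 1
  simp only [angle]
  push_cast
  ring

/-- The exponents `0, a, b` of the coefficients of a spider with phase `(a, b)`. -/
def phaseExponent (a : Phase) (k : Trit) : Trit :=
  if k = 0 then 0 else if k = 1 then a.1 else a.2

theorem spiderCoeff_angle (a : Phase) (k : Trit) :
    spiderCoeff (angle a.1) (angle a.2) k = chi (phaseExponent a k) := by
  unfold spiderCoeff phaseExponent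
  split_ifs <;> simp [exp_angle]

theorem phaseExponent_injective : Function.Injective phaseExponent := by
  intro a b h
  have h1 := congrFun h 1
  have h2 := congrFun h 2
  have e1 : (1 : ZMod 3) ≠ 0 := by decide
  have e2 : (2 : ZMod 3) ≠ 0 := by decide
  have e3 : (2 : ZMod 3) ≠ 1 := by decide
  simp only [phaseExponent, e1, e2, e3, if_true, if_false] at h1 h2
  exact Prod.ext h1 h2

@[simp]
theorem phaseExponent_zero (a : Phase) : phaseExponent a 0 = 0 := by simp [phaseExponent]

/-! ### Vertex operators -/

theorem interp_green (a : Phase) (y x : Trit) :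
    (Node.green a).interp y x = if y = x then chi (phaseExponent a y) else 0 := by
  simp only [Node.interp, greenSpider, spider, ketZ, spiderCoeff_angle]
  simp only [Finset.univ_unique, Finset.prod_singleton]
  by_cases h : y = x <;> simp [h]

theorem interp_red (a : Phase) (y x : Trit) :
    (Node.red a).interp y x = ∑ k, chi (phaseExponent a k + k * (y - x)) := by
  simp only [Node.interp, redSpider, spider, ketX, spiderCoeff_angle, ← chi_apply, star_chi]
  simp only [Finset.univ_unique, Finset.prod_singleton]
  refine Finset.sum_congr rfl fun k _ => ?_
  rw [← AddChar.map_add_eq_mul, ← AddChar.map_add_eq_mul]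
  congr 1
  ring

theorem interp_green_single (a : Phase) (y x : Trit) :
    VertexOp.interp [.green a] y x = if y = x then chi (phaseExponent a y) else 0 := by
  simp [VertexOp.interp, interp_green]

theorem interp_green_red (a b : Phase) (y x : Trit) :
    VertexOp.interp [.green a, .red b] y x =
      (∑ k, chi (phaseExponent b k + k * (y - x))) * chi (phaseExponent a x) := by
  simp only [VertexOp.interp, one_mul, Matrix.mul_apply, interp_green, interp_red]
  simp

/-- Squares in `ZMod 3` take the value 0 once and 1 twice. If `1 + 2 * chi p` vanished, comparison
with `1 + chi p + chi (2 * p) = 0` would give `chi p = chi (2 * p)`. -/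
theorem sum_chi_sq_ne_zero {p : Trit} (hp : p ≠ 0) : ∑ k : Trit, chi (p * k ^ 2) ≠ 0 := by
  have h0 : chi 0 + chi p + chi (2 * p) = 0 := by
    have h := sum_chi_mul p
    rw [if_neg hp] at h
    rw [← h]
    change _ = ∑ x : Fin 3, _
    rw [Fin.sum_univ_three]
    change _ = chi (p * 0) + chi (p * 1) + chi (p * 2)
    rw [mul_zero, mul_one, mul_comm p 2]
  have h1 : ∑ k : Trit, chi (p * k ^ 2) = chi 0 + chi p + chi p := by
    change ∑ x : Fin 3, _ = _
    rw [Fin.sum_univ_three]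
    change chi (p * 0 ^ 2) + chi (p * 1 ^ 2) + chi (p * 2 ^ 2) = _
    have : (2 : ZMod 3) ^ 2 = 1 := by decide
    simp [this]
  intro h
  have h2 : chi p = chi (2 * p) := by linear_combination h - h0 - h1
  have h3 := chi_injective h2
  apply hp
  linear_combination -h3

/-- The displacement caused by the parameter `m`. -/
def RedForm.shift (c : RedForm) (m : Phase) : Trit :=
  if c.onRed then m.1 else -(c.p.1 * m.1)

theorem RedForm.p_cases (c : RedForm) : c.p = (1, 1) ∨ c.p = (2, 2) := by
  simpa [phaseP] using c.mem

theorem RedForm.p_sq (c : RedForm) : c.p.1 * c.p.1 = 1 := by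
  rcases c.p_cases with h | h <;> rw [h] <;> decide

theorem RedForm.p_ne_zero (c : RedForm) : c.p.1 ≠ 0 := by
  rcases c.p_cases with h | h <;> rw [h] <;> decide

theorem RedForm.shift_injOn (c : RedForm) : Set.InjOn c.shift phaseM := by
  intro m hm m' hm' h
  have h1 : m.1 = m'.1 := by
    unfold RedForm.shift at h
    split_ifs at h
    · exact h
    · exact mul_left_cancel₀ c.p_ne_zero (neg_injective h)
  have key : ∀ m ∈ phaseM, m.2 = 2 * m.1 := by
    rintro m (rfl | rfl | rfl) <;> decide
  exact Prod.ext h1 (by rw [key m hm, key m' hm', h1])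

/-- Phases in 𝒫 are purely quadratic and those in ℳ are linear, so a red node amounts to a Gauss
sum. -/
theorem phaseExponent_p (c : RedForm) (k : Trit) : phaseExponent c.p k = c.p.1 * k ^ 2 := by
  rcases c.p_cases with h | h <;> rw [h] <;> revert k <;> decide

theorem phaseExponent_p_add (c : RedForm) {m : Phase} (hm : m ∈ phaseM) (k : Trit) :
    phaseExponent (c.p + m) k = c.p.1 * k ^ 2 + m.1 * k := by
  rcases c.p_cases with h | h <;> rw [h] <;> rcases hm with rfl | rfl | rfl <;> revert k <;> decide

/-- Completing the square: `p⁻¹ = p` and `-2 = 1`, so the centre is `p * e`. -/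
theorem sum_chi_quadratic {p : Trit} (hp : p * p = 1) (e : Trit) :
    ∑ k, chi (p * k ^ 2 + e * k) = (∑ k, chi (p * k ^ 2)) * chi (-(p * e ^ 2)) := by
  rw [Finset.sum_mul, ← Equiv.sum_comp (Equiv.addRight (-(p * e))) (fun k => chi (p * k ^ 2) * _)]
  refine Finset.sum_congr rfl fun k _ => ?_
  rw [← AddChar.map_add_eq_mul]
  congr 1
  have h3 : (3 : ZMod 3) = 0 := rfl
  simp only [Equiv.coe_addRight]
  linear_combination (2 * e * k - p * e ^ 2) * hp + (e * k) * h3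

/-- Up to factors depending on the output only, a reduced vertex operator with a red node is
a Fourier transform, shifted in its output. -/
theorem RedForm.exists_interp_op (c : RedForm) {m : Phase} (hm : m ∈ phaseM) :
    ∃ κ : Trit → ℂ, (∀ y, κ y ≠ 0) ∧
      ∀ y x, (c.op m).interp y x = κ y * chi (-(c.p.1 * (y + c.shift m)) * x) := by
  have h3 : (3 : ZMod 3) = 0 := rfl
  have hp := c.p_sq
  have hg := sum_chi_sq_ne_zero c.p_ne_zero
  by_cases hr : c.onRed
  · refine ⟨fun y => (∑ k, chi (c.p.1 * k ^ 2)) * chi (-(c.p.1 * (y + m.1) ^ 2)),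
      fun y => mul_ne_zero hg (chi_ne_zero _), fun y x => ?_⟩
    simp only [RedForm.op, RedForm.shift, hr, if_true, interp_green_red, phaseExponent_p,
      phaseExponent_p_add c hm]
    have e : ∀ k, c.p.1 * k ^ 2 + m.1 * k + k * (y - x) =
        c.p.1 * k ^ 2 + (m.1 + y - x) * k := fun k => by ring
    -- The completed square contributes `-p * x ^ 2`, which the green node cancels because both
    -- nodes carry the same `p`; only the cross term in `x` remains.
    simp only [e, sum_chi_quadratic hp, mul_assoc, ← AddChar.map_add_eq_mul]
    congr 2
    linear_combination (c.p.1 * (y + m.1) * x) * h3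
  · refine ⟨fun y => (∑ k, chi (c.p.1 * k ^ 2)) * chi (-(c.p.1 * y ^ 2)),
      fun y => mul_ne_zero hg (chi_ne_zero _), fun y x => ?_⟩
    simp only [RedForm.op, RedForm.shift, hr, Bool.false_eq_true, if_false, interp_green_red,
      phaseExponent_p, phaseExponent_p_add c hm]
    have e : ∀ k, c.p.1 * k ^ 2 + k * (y - x) =
        c.p.1 * k ^ 2 + (y - x) * k := fun k => by ring
    simp only [e, sum_chi_quadratic hp, mul_assoc, ← AddChar.map_add_eq_mul]
    congr 2
    linear_combination (c.p.1 * y * x) * h3 - m.1 * x * hp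

theorem RedForm.interp_op_zero_ne_zero (c : RedForm) {m : Phase} (hm : m ∈ phaseM) (y : Trit) :
    (c.op m).interp y 0 ≠ 0 := by
  obtain ⟨κ, hκ, h⟩ := c.exists_interp_op hm
  simpa [h] using hκ y

/-- Taking the column at 0 as the output factor makes it a function of the operator alone, so equal
operators have equal factors. -/
theorem RedForm.interp_op (c : RedForm) {m : Phase} (hm : m ∈ phaseM) (y x : Trit) :
    (c.op m).interp y x = (c.op m).interp y 0 * chi (-(c.p.1 * (y + c.shift m)) * x) := by
  obtain ⟨κ, -, h⟩ := c.exists_interp_op hm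
  simp [h]

theorem RedForm.hasRed_op (c : RedForm) (m : Phase) : (c.op m).HasRed := by
  unfold RedForm.op VertexOp.HasRed
  split_ifs <;> simp

theorem not_hasRed_green (a : Phase) : ¬ VertexOp.HasRed [.green a] := by
  simp [VertexOp.HasRed]

theorem eq_green_of_mem_reducedOps {c : RedForm} {U : VertexOp} (hU : U ∈ reducedOps c)
    (h : ¬ U.HasRed) : ∃ a, U = [.green a] := by
  rcases hU with h' | ⟨m, -, rfl⟩
  · exact h'
  · exact absurd (c.hasRed_op m) h

theorem eq_op_of_mem_reducedOps {c : RedForm} {U : VertexOp} (hU : U ∈ reducedOps c)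
    (h : U.HasRed) : ∃ m ∈ phaseM, U = c.op m := by
  rcases hU with ⟨a, rfl⟩ | h'
  · exact absurd h (not_hasRed_green a)
  · exact h'


/-! ### Graph states -/

namespace WeightedGraph

variable {n : ℕ} (G : WeightedGraph n)

open Matrix in
/-- The sum of `Gᵤᵥ wᵤ wᵥ` over the edges: half, that is twice, its sum over ordered pairs. -/
def phaseForm (w : Fin n → Trit) : Trit := 2 * (w ⬝ᵥ G.adj *ᵥ w)

theorem edgeNode_apply {k : ZMod 3} (hk : k ≠ 0) (y x : Trit) :
    edgeNode k y x = chi (k * (x * y)) := by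
  have h : k = 1 ∨ k = -1 := by revert hk; revert k; decide
  rcases h with rfl | rfl
  · simp [edgeNode, hadamard, ketX, ketZ, chi_apply]
  · have e : (-1 : ZMod 3) ≠ 1 := by decide
    simp only [edgeNode, if_neg e, hadamardDag, ketX, ketZ, ← chi_apply, star_chi]
    simp [mul_comm]

theorem greenSpider_state (N : Type*) [Fintype N] (k : Trit) (z : N → Trit) :
    greenSpider Empty (Option N) 0 0 (fun l => l.elim k z) (fun e => e.elim) =
      if z = fun _ => k then 1 else 0 := by
  have hc : ∀ j, spiderCoeff 0 0 j = 1 := fun j => by simp [spiderCoeff]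
  have ht : ∀ j, spiderCoeff 0 0 j *
      (∏ l : Option N, ketZ j (l.elim k z)) * (∏ e : Empty, star (ketZ j e.elim)) =
      if j = k then (if z = fun _ => k then 1 else 0) else 0 := by
    intro j
    rw [hc, Fintype.prod_option]
    change 1 * (ketZ j k * ∏ u, ketZ j (z u)) * _ = _
    rw [Finset.univ_eq_empty (α := Empty), Finset.prod_empty, mul_one, one_mul]
    simp only [ketZ]
    by_cases hj : j = k
    · subst hj
      rw [if_pos rfl, if_pos rfl, one_mul, Finset.prod_ite_zero, Finset.prod_const_one]
      simp [funext_iff]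
    · rw [if_neg hj, if_neg (fun h => hj h.symm), zero_mul]
  calc _ = ∑ j, if j = k then (if z = fun _ => k then (1 : ℂ) else 0) else 0 :=
        Finset.sum_congr rfl fun j _ => ht j
    _ = _ := by rw [Finset.sum_ite_eq', if_pos (Finset.mem_univ k)]

theorem sum_edge_eq (w : Fin n → Trit) :
    ∑ e : G.Edge, G.adj e.1.1 e.1.2 * (w e.1.1 * w e.1.2) = G.phaseForm w := by
  classical
  set f : Fin n → Fin n → Trit := fun u v => G.adj u v * (w u * w v) with hf
  have hsymm : ∀ u v, f u v = f v u := fun u v => by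
    simp only [hf]; rw [G.symm u v]; ring
  have h1 : ∑ e : G.Edge, G.adj e.1.1 e.1.2 * (w e.1.1 * w e.1.2) =
      ∑ u, ∑ v, if u < v then f u v else 0 := by
    rw [← Fintype.sum_prod_type' (f := fun u v => if u < v then f u v else 0)]
    have h0 : ∀ e : Fin n × Fin n, (if e.1 < e.2 then f e.1 e.2 else 0) =
        if e.1 < e.2 ∧ G.Adj e.1 e.2 then f e.1 e.2 else 0 := by
      intro e
      by_cases he : G.Adj e.1 e.2
      · simp [he]
      · have : G.adj e.1 e.2 = 0 := not_not.mp he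
        simp [hf, this]
    simp_rw [h0]
    rw [← Finset.sum_filter]
    exact (Finset.sum_subtype _ (by simp) fun e : Fin n × Fin n => f e.1 e.2).symm
  have h2 : ∑ u, ∑ v, f u v = 2 * ∑ u, ∑ v, if u < v then f u v else 0 := by
    have h3 : ∀ u v, f u v = (if u < v then f u v else 0) + if v < u then f v u else 0 := by
      intro u v
      rcases lt_trichotomy u v with h | rfl | h
      · simp [h, h.not_gt]
      · simp [hf, G.loopless]
      · simp [h, h.not_gt, hsymm u v]
    simp_rw [two_mul]
    conv_rhs => arg 2; rw [Finset.sum_comm]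
    simp_rw [← Finset.sum_add_distrib, ← h3]
  have h4 : w ⬝ᵥ G.adj.mulVec w = ∑ u, ∑ v, f u v := by
    simp only [dotProduct, Matrix.mulVec, Finset.mul_sum, hf]
    exact Finset.sum_congr rfl fun u _ => Finset.sum_congr rfl fun v _ => by ring
  have e3 : (3 : ZMod 3) = 0 := rfl
  rw [h1, phaseForm, h4, h2]
  -- The factor 2 in `phaseForm` inverts the double counting, as 4 = 1 modulo 3.
  linear_combination -(∑ u, ∑ v, if u < v then f u v else 0) * e3

theorem stateInterp_eq (w : Fin n → Trit) : G.stateInterp w = chi (G.phaseForm w) := by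
  simp only [stateInterp, greenSpider_state]
  rw [Finset.sum_eq_single (fun v _ => w v)]
  · simp only [if_true, Finset.prod_const_one, one_mul]
    rw [← sum_edge_eq, chi_sum]
    exact Finset.prod_congr rfl fun e _ => edgeNode_apply e.2.2 _ _
  · intro z _ hz
    obtain ⟨v, hv⟩ := Function.ne_iff.mp hz
    rw [Finset.prod_eq_zero (Finset.mem_univ v) (if_neg hv), zero_mul]
  · simp

open Matrix in
theorem phaseForm_add (w x : Fin n → Trit) :
    G.phaseForm (w + x) = G.phaseForm w + G.phaseForm x + x ⬝ᵥ G.adj *ᵥ w := by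
  have hs : w ⬝ᵥ G.adj *ᵥ x = x ⬝ᵥ G.adj *ᵥ w := by
    rw [dotProduct_mulVec, dotProduct_comm, ← mulVec_transpose]
    congr 2
    ext u v
    exact G.symm v u
  have e3 : (3 : ZMod 3) = 0 := rfl
  simp only [phaseForm, mulVec_add, dotProduct_add, add_dotProduct, hs]
  linear_combination (x ⬝ᵥ G.adj *ᵥ w) * e3

open Matrix in
theorem phaseForm_eq_zero (A : Finset (Fin n)) (hA : ∀ u ∈ A, ∀ v ∈ A, G.adj u v = 0)
    (x : Fin n → Trit) (hx : ∀ v ∉ A, x v = 0) : G.phaseForm x = 0 := by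
  have : x ⬝ᵥ G.adj *ᵥ x = 0 := by
    simp only [dotProduct, mulVec, Finset.mul_sum]
    refine Finset.sum_eq_zero fun u _ => Finset.sum_eq_zero fun v _ => ?_
    by_cases hu : u ∈ A
    · by_cases hv : v ∈ A
      · rw [hA u hu v hv]; ring
      · rw [hx v hv]; ring
    · rw [hx u hu]; ring
  rw [phaseForm, this, mul_zero]

@[simp]
theorem phaseForm_zero : G.phaseForm 0 = 0 := by simp [phaseForm]

@[simp]
theorem phaseForm_single (v : Fin n) (k : Trit) : G.phaseForm (Pi.single v k) = 0 := by
  simp [phaseForm, G.loopless]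

theorem phaseForm_single_add_single (u v : Fin n) :
    G.phaseForm (Pi.single u 1 + Pi.single v 1) = G.adj u v := by
  rw [phaseForm_add]
  simp [G.symm u v]

end WeightedGraph

/-! ### Fourier transforms on an independent set of a graph state -/

open Matrix

variable {n : ℕ}

/-- `y` with the entries in `A` replaced by zero. -/
def mask (A : Finset (Fin n)) (y : Fin n → Trit) (v : Fin n) : Trit := if v ∈ A then 0 else y v

/-- The state obtained from `|G⟩` by phases outside an independent set `A` and shifted Fourier
transforms on `A`. -/
theorem sum_prod_mul_stateInterp (G : WeightedGraph n) (A : Finset (Fin n))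
    (hA : ∀ u ∈ A, ∀ v ∈ A, G.adj u v = 0) (M : Fin n → Matrix Trit Trit ℂ)
    (φ t : Fin n → Trit → Trit) (κ : Fin n → Trit → ℂ)
    (hM : ∀ v ∉ A, ∀ y x, M v y x = if y = x then chi (φ v y) else 0)
    (hM' : ∀ v ∈ A, ∀ y x, M v y x = κ v y * chi (t v y * x)) (y : Fin n → Trit) :
    ∑ w : Fin n → Trit, (∏ v, M v (y v) (w v)) * G.stateInterp w =
      chi (G.phaseForm (mask A y)) * ∏ v, if v ∈ A then
        κ v (y v) * (if t v (y v) + (G.adj *ᵥ mask A y) v = 0 then 3 else 0)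
        else chi (φ v (y v)) := by
  have hterm : ∀ w : Fin n → Trit, (∏ v, M v (y v) (w v)) * G.stateInterp w =
      chi (G.phaseForm (mask A y)) * ∏ v, M v (y v) (w v) *
        (if v ∈ A then chi ((G.adj *ᵥ mask A y) v * w v) else 1) := by
    intro w
    -- Off `A` the matrices are diagonal, so only those `w` contribute that agree with `y` there.
    by_cases hw : ∀ v ∉ A, y v = w v
    · set x : Fin n → Trit := fun v => if v ∈ A then w v else 0 with hx
      have hwx : w = mask A y + x := by
        ext v
        by_cases hv : v ∈ A <;> simp [mask, hx, hv, hw]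
      have hdot : chi (x ⬝ᵥ G.adj *ᵥ mask A y) =
          ∏ v, if v ∈ A then chi ((G.adj *ᵥ mask A y) v * w v) else 1 := by
        rw [dotProduct, chi_sum]
        refine Finset.prod_congr rfl fun v _ => ?_
        by_cases hv : v ∈ A <;> simp [hx, hv, mul_comm]
      have hstate : G.stateInterp w = chi (G.phaseForm (mask A y)) *
          chi (x ⬝ᵥ G.adj *ᵥ mask A y) := by
        rw [G.stateInterp_eq, ← AddChar.map_add_eq_mul]
        conv_lhs => rw [hwx]
        -- Independence of `A` removes the quadratic part in `x`; the exponent is affine in `x`.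
        rw [G.phaseForm_add, G.phaseForm_eq_zero A hA x (fun v hv => by simp [hx, hv]), add_zero]
      rw [hstate, hdot, Finset.prod_mul_distrib]
      ring
    · push Not at hw
      obtain ⟨v, hv, hne⟩ := hw
      have h0 : M v (y v) (w v) = 0 := by rw [hM v hv, if_neg hne]
      rw [Finset.prod_eq_zero (Finset.mem_univ v) h0,
        Finset.prod_eq_zero (Finset.mem_univ v) (by rw [h0, zero_mul])]
      ring
  simp_rw [hterm]
  rw [← Finset.mul_sum]
  congr 1
  -- The sum factors over the vertices, and each factor on `A` is a complete character sum.
  rw [← Fintype.prod_sum (fun v k => M v (y v) k *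
        (if v ∈ A then chi ((G.adj *ᵥ mask A y) v * k) else 1))]
  refine Finset.prod_congr rfl fun v _ => ?_
  by_cases hv : v ∈ A
  · simp only [hv, if_true, hM' v hv, mul_assoc, ← AddChar.map_add_eq_mul, ← add_mul]
    rw [← Finset.mul_sum, sum_chi_mul]
  · simp [hv, hM v hv]

/-- The vertices whose operators have a red node. -/
noncomputable def GSLC.redSet (D : GSLC n) : Finset (Fin n) :=
  open Classical in Finset.univ.filter fun v => (D.op v).HasRed

theorem GSLC.mem_redSet {D : GSLC n} {v : Fin n} : v ∈ D.redSet ↔ (D.op v).HasRed := by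
  simp [GSLC.redSet]

/-! ### Interpretation of reduced diagrams -/

namespace GSLC

variable {c : Fin n → RedForm} {D D₁ D₂ : GSLC n}

/-- The phases `a` of the green vertex operators and the parameters `m` of the others. -/
structure HasParams (c : Fin n → RedForm) (D : GSLC n) (a m : Fin n → Phase) : Prop where
  indep : ∀ u ∈ D.redSet, ∀ v ∈ D.redSet, D.graph.adj u v = 0
  mem : ∀ v ∈ D.redSet, m v ∈ phaseM
  green : ∀ v ∉ D.redSet, D.op v = [.green (a v)]
  red : ∀ v ∈ D.redSet, D.op v = (c v).op (m v)

theorem IsReduced.exists_hasParams (h : D.IsReduced c) : ∃ a m, HasParams c D a m := by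
  have h1 : ∀ v, ∃ a, v ∉ D.redSet → D.op v = [.green a] := fun v => by
    by_cases hv : v ∈ D.redSet
    · exact ⟨0, fun h => absurd hv h⟩
    · obtain ⟨a, ha⟩ := eq_green_of_mem_reducedOps (h.op_mem v) (mem_redSet.not.mp hv)
      exact ⟨a, fun _ => ha⟩
  have h2 : ∀ v, ∃ m, v ∈ D.redSet → m ∈ phaseM ∧ D.op v = (c v).op m := fun v => by
    by_cases hv : v ∈ D.redSet
    · obtain ⟨m, hm⟩ := eq_op_of_mem_reducedOps (h.op_mem v) (mem_redSet.mp hv)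
      exact ⟨m, fun _ => hm⟩
    · exact ⟨0, fun h => absurd h hv⟩
  choose a ha using h1
  choose m hm using h2
  refine ⟨a, m, fun u hu v hv => ?_, fun v hv => (hm v hv).1, ha, fun v hv => (hm v hv).2⟩
  by_contra huv
  exact h.not_both_red u v huv ⟨mem_redSet.mp hu, mem_redSet.mp hv⟩

namespace HasParams

variable {a m a₁ m₁ a₂ m₂ : Fin n → Phase}

theorem interp_eq (h : HasParams c D a m) (y : Fin n → Trit) :
    D.interp y = chi (D.graph.phaseForm (mask D.redSet y)) * ∏ v, if v ∈ D.redSet then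
      (D.op v).interp (y v) 0 *
        (if -((c v).p.1 * (y v + (c v).shift (m v))) +
          (D.graph.adj *ᵥ mask D.redSet y) v = 0 then 3 else 0)
      else chi (phaseExponent (a v) (y v)) :=
  sum_prod_mul_stateInterp D.graph D.redSet h.indep (fun v => (D.op v).interp)
    (fun v => phaseExponent (a v)) (fun v k => -((c v).p.1 * (k + (c v).shift (m v))))
    (fun v k => (D.op v).interp k 0)
    (fun v hv y x => by rw [h.green v hv, interp_green_single])
    (fun v hv y x => by rw [h.red v hv]; exact (c v).interp_op (h.mem v hv) y x) y

theorem interp_ne_zero_iff (h : HasParams c D a m) (y : Fin n → Trit) :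
    D.interp y ≠ 0 ↔ ∀ v ∈ D.redSet,
      (c v).p.1 * (y v + (c v).shift (m v)) = (D.graph.adj *ᵥ mask D.redSet y) v := by
  rw [h.interp_eq, mul_ne_zero_iff_left (chi_ne_zero _), Finset.prod_ne_zero_iff]
  refine ⟨fun H v hv => ?_, fun H v _ => ?_⟩
  · have := H v (Finset.mem_univ v)
    rw [if_pos hv] at this
    by_contra hne
    rw [if_neg (fun h0 => hne (neg_add_eq_zero.mp h0)), mul_zero] at this
    exact this rfl
  · by_cases hv : v ∈ D.redSet
    · rw [if_pos hv, if_pos (neg_add_eq_zero.mpr (H v hv)), h.red v hv]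
      exact mul_ne_zero ((c v).interp_op_zero_ne_zero (h.mem v hv) _) (by norm_num)
    · rw [if_neg hv]
      exact chi_ne_zero _

end HasParams

/-- The vector in the support that agrees with `z` off the vertices with a red node. -/
noncomputable def lift (c : Fin n → RedForm) (D : GSLC n) (m : Fin n → Phase) (z : Fin n → Trit)
    (v : Fin n) : Trit :=
  if v ∈ D.redSet then (c v).p.1 * (D.graph.adj *ᵥ mask D.redSet z) v - (c v).shift (m v)
  else z v

/-- The phase of a reduced diagram on the support. -/
def phase (D : GSLC n) (a : Fin n → Phase) (z : Fin n → Trit) : Trit :=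
  D.graph.phaseForm z + ∑ v, phaseExponent (a v) (z v)

theorem phase_single (D : GSLC n) (a : Fin n → Phase) (v : Fin n) (k : Trit) :
    phase D a (Pi.single v k) = phaseExponent (a v) k := by
  rw [phase, D.graph.phaseForm_single, zero_add, Finset.sum_eq_single v]
  · rw [Pi.single_eq_same]
  · intro u _ hu
    rw [Pi.single_eq_of_ne hu, phaseExponent_zero]
  · simp

theorem mask_lift (m : Fin n → Phase) (z : Fin n → Trit) :
    mask D.redSet (D.lift c m z) = mask D.redSet z := by
  ext v
  by_cases hv : v ∈ D.redSet <;> simp [mask, lift, hv]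

/-! ### Comparing supports -/

namespace HasParams

variable {a m a₁ m₁ a₂ m₂ : Fin n → Phase}

theorem interp_lift_ne_zero (h : HasParams c D a m) (z : Fin n → Trit) :
    D.interp (D.lift c m z) ≠ 0 := by
  rw [h.interp_ne_zero_iff, mask_lift]
  intro v hv
  simp only [lift, if_pos hv]
  linear_combination (D.graph.adj *ᵥ mask D.redSet z) v * (c v).p_sq

/-- Suppose `u` is red in `D₁` only. Its neighbours in `D₁` are green there by independence, and
green in `D₂` because the pair is simplified. So in the support of `D₂` the coordinate at `u` varies
while these neighbours stay zero, against the equation of `D₁` at `u`. -/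
theorem redSet_subset (h₁ : HasParams c D₁ a₁ m₁) (h₂ : HasParams c D₂ a₂ m₂)
    (hs : D₁.IsSimplifiedPair D₂) (hsupp : ∀ y, D₂.interp y ≠ 0 → D₁.interp y ≠ 0) :
    D₁.redSet ⊆ D₂.redSet := by
  intro u hu
  by_contra hu₂
  have hnbr : ∀ v, D₁.graph.adj u v ≠ 0 → v ∉ D₁.redSet ∧ v ∉ D₂.redSet := by
    intro v huv
    have hv : v ∉ D₁.redSet := fun hv => huv (h₁.indep u hu v hv)
    refine ⟨hv, fun hv₂ => hs ⟨u, v, ⟨mem_redSet.mp hu, mem_redSet.not.mp hu₂⟩,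
      ⟨mem_redSet.mp hv₂, mem_redSet.not.mp hv⟩, Or.inl huv⟩⟩
  have key : ∀ k : Trit, (c u).p.1 * (k + (c u).shift (m₁ u)) = 0 := by
    intro k
    have h := (h₁.interp_ne_zero_iff _).mp
      (hsupp _ (h₂.interp_lift_ne_zero (Pi.single u k))) u hu
    have hl : D₂.lift c m₂ (Pi.single u k) u = k := by simp [lift, hu₂]
    rw [hl] at h
    rw [h]
    rw [mulVec, dotProduct]
    refine Finset.sum_eq_zero fun v _ => ?_
    by_cases huv : D₁.graph.adj u v = 0
    · rw [huv, zero_mul]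
    · obtain ⟨hv₁, hv₂⟩ := hnbr v huv
      have hne : v ≠ u := fun e => huv (by rw [e, D₁.graph.loopless])
      simp [mask, lift, hv₁, hv₂, hne]
  apply (c u).p_ne_zero
  linear_combination key 1 - key 0

/-- Both supports are graphs over the same green coordinates: a point of the second is substituted
into the equations of the first. -/
theorem affine_eq (h₁ : HasParams c D₁ a₁ m₁) (h₂ : HasParams c D₂ a₂ m₂)
    (hA : D₁.redSet = D₂.redSet) (hsupp : ∀ y, D₂.interp y ≠ 0 → D₁.interp y ≠ 0)
    (z : Fin n → Trit) {v : Fin n} (hv : v ∈ D₁.redSet) :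
    (D₂.graph.adj *ᵥ mask D₁.redSet z) v +
      (c v).p.1 * ((c v).shift (m₁ v) - (c v).shift (m₂ v)) =
      (D₁.graph.adj *ᵥ mask D₁.redSet z) v := by
  have h := (h₁.interp_ne_zero_iff _).mp (hsupp _ (h₂.interp_lift_ne_zero z)) v hv
  rw [hA, mask_lift, ← hA] at h
  rw [← h]
  simp only [lift, ← hA, if_pos hv]
  linear_combination -(D₂.graph.adj *ᵥ mask D₁.redSet z) v * (c v).p_sq

theorem param_eq (h₁ : HasParams c D₁ a₁ m₁) (h₂ : HasParams c D₂ a₂ m₂)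
    (hA : D₁.redSet = D₂.redSet) (hsupp : ∀ y, D₂.interp y ≠ 0 → D₁.interp y ≠ 0)
    {v : Fin n} (hv : v ∈ D₁.redSet) : m₁ v = m₂ v := by
  apply (c v).shift_injOn (h₁.mem v hv) (h₂.mem v (hA ▸ hv))
  -- At `z = 0` only the constant terms are compared.
  have h := h₁.affine_eq h₂ hA hsupp 0 hv
  have h0 : mask D₁.redSet (0 : Fin n → Trit) = 0 := by ext; simp [mask]
  rw [h0, mulVec_zero, mulVec_zero, Pi.zero_apply, zero_add] at h
  exact sub_eq_zero.mp ((mul_eq_zero.mp h).resolve_left (c v).p_ne_zero)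

theorem adj_eq_of_mem (h₁ : HasParams c D₁ a₁ m₁) (h₂ : HasParams c D₂ a₂ m₂)
    (hA : D₁.redSet = D₂.redSet) (hsupp : ∀ y, D₂.interp y ≠ 0 → D₁.interp y ≠ 0)
    {u : Fin n} (hu : u ∈ D₁.redSet) (v : Fin n) : D₁.graph.adj u v = D₂.graph.adj u v := by
  by_cases hv : v ∈ D₁.redSet
  · rw [h₁.indep u hu v hv, h₂.indep u (hA ▸ hu) v (hA ▸ hv)]
  · have h := h₁.affine_eq h₂ hA hsupp (Pi.single v 1) hu
    have h0 : mask D₁.redSet (Pi.single v 1) = Pi.single v 1 := by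
      ext w
      by_cases hw : w ∈ D₁.redSet
      · have : w ≠ v := fun e => hv (e ▸ hw)
        simp [mask, hw, this]
      · simp [mask, hw]
    rw [h0, h₁.param_eq h₂ hA hsupp hu, sub_self, mul_zero, add_zero] at h
    simpa using h.symm

/-! ### Comparing phases on the common support -/

theorem interp_lift_eq (h : HasParams c D a m) (z : Fin n → Trit) (hz : ∀ v ∈ D.redSet, z v = 0) :
    D.interp (D.lift c m z) = chi (phase D a z) *
      ∏ v ∈ D.redSet, (D.op v).interp (D.lift c m z v) 0 * 3 := by
  have hzm : mask D.redSet z = z := by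
    ext v
    by_cases hv : v ∈ D.redSet <;> simp [mask, hv, hz]
  rw [h.interp_eq, mask_lift, hzm, phase, AddChar.map_add_eq_mul, mul_assoc, chi_sum,
    ← Fintype.prod_ite_mem D.redSet, ← Finset.prod_mul_distrib]
  congr 1
  refine Finset.prod_congr rfl fun v _ => ?_
  by_cases hv : v ∈ D.redSet
  · rw [if_pos hv, if_pos hv, hz v hv, phaseExponent_zero, AddChar.map_zero_eq_one, one_mul,
      if_pos]
    simp only [lift, if_pos hv, hzm]
    linear_combination -(D.graph.adj *ᵥ z) v * (c v).p_sq
  · rw [if_neg hv, if_neg hv, mul_one, lift, if_neg hv]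

theorem lift_eq (h₁ : HasParams c D₁ a₁ m₁) (h₂ : HasParams c D₂ a₂ m₂)
    (hA : D₁.redSet = D₂.redSet) (hsupp : ∀ y, D₂.interp y ≠ 0 → D₁.interp y ≠ 0)
    (z : Fin n → Trit) : D₁.lift c m₁ z = D₂.lift c m₂ z := by
  ext v
  by_cases hv : v ∈ D₁.redSet
  · have h := h₁.affine_eq h₂ hA hsupp z hv
    simp only [lift, ← hA, if_pos hv, ← h, h₁.param_eq h₂ hA hsupp hv, sub_self, mul_zero, add_zero]
  · simp [lift, hv, ← hA]

theorem op_eq_of_mem (h₁ : HasParams c D₁ a₁ m₁) (h₂ : HasParams c D₂ a₂ m₂)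
    (hA : D₁.redSet = D₂.redSet) (hsupp : ∀ y, D₂.interp y ≠ 0 → D₁.interp y ≠ 0)
    {v : Fin n} (hv : v ∈ D₁.redSet) : D₁.op v = D₂.op v := by
  rw [h₁.red v hv, h₂.red v (hA ▸ hv), h₁.param_eq h₂ hA hsupp hv]

/-- The red operators and the lifts coincide, so the nonzero products of output factors cancel,
leaving the phases and the scalar `r`. -/
theorem phase_eq (h₁ : HasParams c D₁ a₁ m₁) (h₂ : HasParams c D₂ a₂ m₂)
    (hA : D₁.redSet = D₂.redSet) (hsupp : ∀ y, D₂.interp y ≠ 0 → D₁.interp y ≠ 0)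
    {r : ℂ} (hr : D₁.interp = r • D₂.interp) (z : Fin n → Trit)
    (hz : ∀ v ∈ D₁.redSet, z v = 0) : phase D₁ a₁ z = phase D₂ a₂ z := by
  have key : ∀ z : Fin n → Trit, (∀ v ∈ D₁.redSet, z v = 0) →
      chi (phase D₁ a₁ z) = r * chi (phase D₂ a₂ z) := by
    intro z hz
    have h := congrFun hr (D₁.lift c m₁ z)
    rw [Pi.smul_apply, smul_eq_mul] at h
    conv_rhs at h => rw [h₁.lift_eq h₂ hA hsupp]
    have hne := h₁.interp_lift_ne_zero z
    rw [h₁.interp_lift_eq z hz] at h hne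
    rw [h₂.interp_lift_eq z (hA ▸ hz), ← mul_assoc] at h
    have hprod : ∏ v ∈ D₁.redSet, (D₁.op v).interp (D₁.lift c m₁ z v) 0 * 3 =
        ∏ v ∈ D₂.redSet, (D₂.op v).interp (D₂.lift c m₂ z v) 0 * 3 := by
      rw [← hA]
      refine Finset.prod_congr rfl fun v hv => ?_
      rw [h₁.op_eq_of_mem h₂ hA hsupp hv, h₁.lift_eq h₂ hA hsupp]
    rw [← hprod] at h
    exact mul_right_cancel₀ (right_ne_zero_of_mul hne) h
  -- Both phases vanish at `z = 0`.
  have hr1 : r = 1 := by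
    have h := key 0 fun _ _ => rfl
    simpa [phase] using h.symm
  apply chi_injective
  rw [key z hz, hr1, one_mul]

theorem eq_of_interp_eq (h₁ : HasParams c D₁ a₁ m₁) (h₂ : HasParams c D₂ a₂ m₂)
    (hA : D₁.redSet = D₂.redSet) (hsupp : ∀ y, D₂.interp y ≠ 0 → D₁.interp y ≠ 0)
    {r : ℂ} (hr : D₁.interp = r • D₂.interp) :
    D₁.graph = D₂.graph ∧ ∀ v, D₁.op v = D₂.op v := by
  have hphase := h₁.phase_eq h₂ hA hsupp hr
  have hsingle : ∀ v ∉ D₁.redSet, ∀ k : Trit, ∀ u ∈ D₁.redSet,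
      (Pi.single v k : Fin n → Trit) u = 0 := fun v hv k u hu => by
    rw [Pi.single_eq_of_ne (ne_of_mem_of_not_mem hu hv)]
  have ha : ∀ v ∉ D₁.redSet, a₁ v = a₂ v := by
    intro v hv
    apply phaseExponent_injective
    ext1 k
    rw [← phase_single D₁ a₁ v k, ← phase_single D₂ a₂ v k]
    exact hphase _ (hsingle v hv k)
  have hop : ∀ v, D₁.op v = D₂.op v := by
    intro v
    by_cases hv : v ∈ D₁.redSet
    · exact h₁.op_eq_of_mem h₂ hA hsupp hv
    · rw [h₁.green v hv, h₂.green v (hA ▸ hv), ha v hv]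
  refine ⟨WeightedGraph.ext ?_, hop⟩
  ext u v
  by_cases hu : u ∈ D₁.redSet
  · exact h₁.adj_eq_of_mem h₂ hA hsupp hu v
  by_cases hv : v ∈ D₁.redSet
  · rw [D₁.graph.symm, D₂.graph.symm]
    exact h₁.adj_eq_of_mem h₂ hA hsupp hv u
  have hz : ∀ w ∈ D₁.redSet, (Pi.single u 1 + Pi.single v 1 : Fin n → Trit) w = 0 := by
    intro w hw
    rw [Pi.add_apply, hsingle u hu 1 w hw, hsingle v hv 1 w hw, add_zero]
  have h := hphase _ hz
  -- The green phases are already known to agree, so what survives of the phase is the weight of the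
  -- edge between `u` and `v`.
  have hsum : ∑ w, phaseExponent (a₁ w) ((Pi.single u 1 + Pi.single v 1 : Fin n → Trit) w) =
      ∑ w, phaseExponent (a₂ w) ((Pi.single u 1 + Pi.single v 1 : Fin n → Trit) w) := by
    refine Finset.sum_congr rfl fun w _ => ?_
    by_cases hw : w ∈ D₁.redSet
    · rw [hz w hw, phaseExponent_zero, phaseExponent_zero]
    · rw [ha w hw]
  rw [phase, phase, hsum, WeightedGraph.phaseForm_single_add_single,
    WeightedGraph.phaseForm_single_add_single] at h
  exact add_right_cancel h

end HasParams

theorem IsSimplifiedPair.symm (h : D₁.IsSimplifiedPair D₂) : D₂.IsSimplifiedPair D₁ := by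
  rintro ⟨a, b, ha, hb, hab⟩
  exact h ⟨b, a, hb, ha, hab.symm.imp WeightedGraph.Adj.symm' WeightedGraph.Adj.symm'⟩

end GSLC
end QutritZX

theorem mainTheorem4 {n : ℕ} (c : Fin n → QutritZX.RedForm) (D₁ D₂ : QutritZX.GSLC n)
    (h₁ : D₁.IsReduced c) (h₂ : D₂.IsReduced c) (hs : D₁.IsSimplifiedPair D₂) :
    D₁.EqualInterp D₂ ↔ D₁.graph = D₂.graph ∧ ∀ v, D₁.op v = D₂.op v := by
  constructor
  · rintro ⟨r, hr0, hr⟩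
    obtain ⟨a₁, m₁, p₁⟩ := h₁.exists_hasParams
    obtain ⟨a₂, m₂, p₂⟩ := h₂.exists_hasParams
    have hsupp : ∀ y, D₁.interp y ≠ 0 ↔ D₂.interp y ≠ 0 := fun y => by
      rw [hr, Pi.smul_apply, smul_eq_mul, mul_ne_zero_iff_left hr0]
    exact p₁.eq_of_interp_eq p₂
      (Finset.Subset.antisymm (p₁.redSet_subset p₂ hs fun y => (hsupp y).mpr)
        (p₂.redSet_subset p₁ hs.symm fun y => (hsupp y).mp))
      (fun y => (hsupp y).mpr) hr
  · rintro ⟨hg, hop⟩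
    refine ⟨1, one_ne_zero, ?_⟩
    rw [one_smul, QutritZX.GSLC.ext hg (funext hop)]
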